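/- Let $\nu$ be a valuation of a field $L$ with valuation ring $R_\nu$ and value group $\Gamma=\nu(L^*)$ of finite rank $r$, and let $\Gamma=\Delta_0\supsetneqq\Delta_1\supsetneqq\dots\supsetneqq\Delta_r=(0)$ be all the isolated (i.e. convex) subgroups of $\Gamma$. Let $(R,m)$ be a noetherian local domain contained in $R_\nu$ and dominated by it (that is, $\mathbf m_\nu\cap R=m$). Let $\mathcal T$ be a set of noetherian local $R$-subalgebras $R'$ of $R_\nu$, with $R\in\mathcal T$, such that * each $R'\in\mathcal T$ is dominated by $R_\nu$ and dominates $R$, and $\mathcal T$ is directed by inclusion (in what follows, direct limits are taken over subsets of $\mathcal T$, with the inclusions as transition maps; these are local homomorphisms); * if $R'\in\mathcal T$ and $R''$ is a local ring dominated by $R_\nu$ which is an essentially of finite type local extension of $R'$ with the same field of fractions, then $R''\in\mathcal T$; * $L$ is the union of the fields of fractions of the rings $R'\in\mathcal T$. For $S\in\mathcal T$ let $\mathcal T(S)$ be the set of $S'\in\mathcal T$ containing $S$, let $\hat S$ be the completion of $S$ with respect to its maximal ideal $m_S$, and for $\beta\in\Gamma$ put $\mathcal P_\beta(S)=\{x\in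 S\mid \nu(x)\ge\beta\}$. The odd implicit ideals of $\hat S$ are $$H_{2\ell+1}(S)=\bigcap_{\beta\in\Delta_\ell}\Big(\big(\varinjlim_{S'\in\mathcal T(S)}\mathcal P_\beta(S')\hat S'\big)\cap\hat S\Big)\quad(0\le\ell<r),\qquad H_{2r+1}(S)=m_S\hat S,$$ where $\varinjlim \mathcal P_\beta(S')\hat S'$ is viewed as an ideal of the ring $\varinjlim_{S'\in\mathcal T(S)}\hat S'$ and $\cap\,\hat S$ stands for the preimage under the canonical map from $\hat S$ to that ring. Then, for all $R',R''\in\mathcal T$ with $R'\subseteq R''$ (in particular for $R'=R$) and all $0\le\ell\le r$, $$H_{2\ell+1}(R'')\cap\hat R'=H_{2\ell+1}(R'),$$ where the left-hand side is the preimage of $H_{2\ell+1}(R'')$ under the natural homomorphism of completions $\hat R'\to\hat R''$. -/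

import Mathlib

namespace ImplicitIdeal

open IsLocalRing

/-! ### Isolated subgroups and rank -/

/-- A subgroup of an ordered abelian group is isolated if it contains, together with any
nonnegative element, all the elements between `0` and that element. -/
def IsIsolated {Γ : Type*} [AddCommGroup Γ] [LinearOrder Γ] (D : AddSubgroup Γ) : Prop :=
  ∀ a b : Γ, 0 ≤ a → a ≤ b → b ∈ D → a ∈ D

/-- `Δ 0 ⊋ Δ 1 ⊋ ⋯ ⊋ Δ r` is the list of all the isolated subgroups of `Γ`
(so `Δ 0 = Γ`, `Δ r = 0`, and `Γ` has rank `r`). -/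
structure IsIsolatedChain {Γ : Type*} [AddCommGroup Γ] [LinearOrder Γ] {r : ℕ}
    (Δ : Fin (r + 1) → AddSubgroup Γ) : Prop where
  strictAnti : StrictAnti Δ
  mem_range_iff : ∀ D : AddSubgroup Γ, D ∈ Set.range Δ ↔ IsIsolated D

/-! ### Completions of local subrings -/

section Completion

variable {L : Type*} [Field L]

/-- The completion `Ŝ` of a local ring `S` with respect to its maximal ideal. -/
abbrev Completion (S : LocalSubring L) : Type _ :=
  AdicCompletion (maximalIdeal S.toSubring) S.toSubring

/-- The inclusion `S → S'` when `S'` dominates `S`. -/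
def incl {S S' : LocalSubring L} (h : S ≤ S') : S.toSubring →+* S'.toSubring :=
  Subring.inclusion h.1

theorem maximalIdeal_pow_le_comap {S S' : LocalSubring L} (h : S ≤ S') (n : ℕ) :
    maximalIdeal S.toSubring ^ n ≤ (maximalIdeal S'.toSubring ^ n).comap (incl h) := by
  have := h.2
  have h1 : maximalIdeal S.toSubring ≤ (maximalIdeal S'.toSubring).comap (incl h) :=
    ((local_hom_TFAE (incl h)).out 0 3).mp this
  exact (Ideal.pow_right_mono h1 n).trans (Ideal.le_comap_pow _ n)

/-- The map `Ŝ → S / m ^ n → S' / m' ^ n` induced by a local inclusion `S → S'`. -/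
noncomputable def completionMapAux {S S' : LocalSubring L} (h : S ≤ S') (n : ℕ) :
    Completion S →+* S'.toSubring ⧸ maximalIdeal S'.toSubring ^ n :=
  (Ideal.quotientMap (maximalIdeal S'.toSubring ^ n) (incl h)
    (maximalIdeal_pow_le_comap h n)).comp
      (AdicCompletion.evalₐ (maximalIdeal S.toSubring) n).toRingHom

theorem factorPow_comp_completionMapAux {S S' : LocalSubring L} (h : S ≤ S') {m n : ℕ}
    (hle : m ≤ n) :
    (Ideal.Quotient.factorPow (maximalIdeal S'.toSubring) hle).comp (completionMapAux h n) =
      completionMapAux h m := by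
  ext x
  obtain ⟨x, rfl⟩ := AdicCompletion.mk_surjective _ _ x
  simp only [completionMapAux, RingHom.comp_apply, AlgHom.toRingHom_eq_coe, RingHom.coe_coe,
    AdicCompletion.evalₐ_mk, Ideal.quotientMap_mk, Ideal.Quotient.factorPow,
    Ideal.Quotient.factor_mk]
  rw [← Ideal.quotientMap_mk (I := maximalIdeal S'.toSubring ^ m) (f := incl h)
      (H := maximalIdeal_pow_le_comap h m),
    ← Ideal.quotientMap_mk (I := maximalIdeal S'.toSubring ^ m) (f := incl h)
      (H := maximalIdeal_pow_le_comap h m)]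
  exact congrArg _ (AdicCompletion.Ideal.mk_eq_mk _ hle x)

/-- The homomorphism `Ŝ → Ŝ'` of completions induced by a local inclusion `S → S'`:
it is the inverse limit of the maps `S / m ^ n → S' / m' ^ n`. -/
noncomputable def completionMap {S S' : LocalSubring L} (h : S ≤ S') :
    Completion S →+* Completion S' :=
  AdicCompletion.liftRingHom (maximalIdeal S'.toSubring) (completionMapAux h)
    (factorPow_comp_completionMapAux h)

end Completion

/-! ### Trees of `ν`-extensions -/

section Tree

variable {L : Type*} [Field L]
variable {Γ : Type*} [AddCommGroup Γ] [LinearOrder Γ] [IsOrderedAddMonoid Γ]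

/-- The valuation ring `R_ν = {x | ν x ≥ 0}`, as a local subring. -/
noncomputable def valuationRing (ν : AddValuation L (WithTop Γ)) : LocalSubring L :=
  (AddValuation.toValuation ν).valuationSubring.toLocalSubring

theorem mem_valuationRing {ν : AddValuation L (WithTop Γ)} {x : L} :
    x ∈ (valuationRing ν).toSubring ↔ 0 ≤ ν x := Iff.rfl

/-- The `ν`-ideal `P_β(S) = {x ∈ S | ν x ≥ β}` of a ring `S` dominated by `R_ν`. -/
def valuationIdeal {ν : AddValuation L (WithTop Γ)} {S : LocalSubring L}
    (hS : S ≤ valuationRing ν) (β : Γ) : Ideal S.toSubring where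
  carrier := {x | (β : WithTop Γ) ≤ ν (x : L)}
  add_mem' {x y} hx hy := (le_min hx hy).trans (ν.map_add x y)
  zero_mem' := by simp
  smul_mem' c x hx := by
    have hc : 0 ≤ ν (c : L) := mem_valuationRing.mp (hS.1 c.2)
    have : (β : WithTop Γ) ≤ ν ((c : L) * x) := by
      rw [ν.map_mul]
      exact le_add_of_nonneg_of_le hc hx
    exact this

/-- `S → S'` is a birational extension of local rings: an essentially of finite type local
inclusion inducing an equality of the fraction fields (taken inside `L`). -/
structure IsBirationalExtension (S S' : LocalSubring L) : Prop where
  le : S ≤ S'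
  essFiniteType : (incl le).EssFiniteType
  fractionField_eq : Subfield.closure (S.toSubring : Set L) = Subfield.closure (S'.toSubring : Set L)

/-- A tree `𝒯` of noetherian local `R`-subalgebras of `R_ν`. Members are ordered by domination;
as they are all dominated by `R_ν`, this is the same as inclusion. -/
structure NuTree (ν : AddValuation L (WithTop Γ)) (R : LocalSubring L) where
  carrier : Set (LocalSubring L)
  base_mem : R ∈ carrier
  base_le : ∀ S ∈ carrier, R ≤ S
  le_valuationRing : ∀ S ∈ carrier, S ≤ valuationRing ν
  isNoetherianRing : ∀ S ∈ carrier, IsNoetherianRing S.toSubring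
  directed : DirectedOn (· ≤ ·) carrier
  birational_mem : ∀ S ∈ carrier, ∀ S' : LocalSubring L, IsBirationalExtension S S' →
    S' ≤ valuationRing ν → S' ∈ carrier
  exists_mem_fractionField : ∀ x : L, ∃ S ∈ carrier, x ∈ Subfield.closure (S.toSubring : Set L)

namespace NuTree

variable {ν : AddValuation L (WithTop Γ)} {R : LocalSubring L} (T : NuTree ν R)

/-- `𝒯(S)`: the members of the tree which are `ν`-extensions of `S`. -/
abbrev Over (S : T.carrier) : Type _ := {S' : T.carrier // S ≤ S'}

/-- The direct limit of the completions `Ŝ'`, for `S'` in `𝒯(S)`. -/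
abbrev LimCompletion (S : T.carrier) : Type _ :=
  Ring.DirectLimit (fun S' : T.Over S => Completion S'.1.1)
    (fun _ _ h => completionMap h)

/-- The canonical map `Ŝ' → lim Ŝ''`, for `S'` in `𝒯(S)`. -/
noncomputable abbrev toLim (S : T.carrier) (S' : T.Over S) :
    Completion S'.1.1 →+* T.LimCompletion S :=
  Ring.DirectLimit.of (fun S' : T.Over S => Completion S'.1.1)
    (fun _ _ h => completionMap h) S'

/-- The extended ideal `P'_β Ŝ'`. -/
noncomputable def completedIdeal (S : T.carrier) (β : Γ) : Ideal (Completion S.1) :=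
  (valuationIdeal (T.le_valuationRing S.1 S.2) β).map (algebraMap S.1.toSubring (Completion S.1))

/-- The limit of the ideals `P'_β Ŝ'`, as an ideal of the limit of the rings `Ŝ'`, for `S'` in
`𝒯(S)`: the ideal generated by the images of all of them (the union of the images, since the
tree is directed). -/
noncomputable def limIdeal (S : T.carrier) (β : Γ) : Ideal (T.LimCompletion S) :=
  ⨆ S' : T.Over S, (T.completedIdeal S'.1 β).map (T.toLim S S')

/-- The odd implicit ideal `H_{2ℓ+1}` of `Ŝ`, for `0 ≤ ℓ ≤ r`: the intersection, over `β` in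
`Δ ℓ`, of the preimages in `Ŝ` of the limits of the `P'_β Ŝ'` if `ℓ < r`, and `m Ŝ` if `ℓ = r`. -/
noncomputable def oddImplicitIdeal {r : ℕ} (Δ : Fin (r + 1) → AddSubgroup Γ) (S : T.carrier)
    (l : Fin (r + 1)) : Ideal (Completion S.1) :=
  if l < Fin.last r then
    ⨅ β ∈ Δ l, (T.limIdeal S β).comap (T.toLim S ⟨S, le_rfl⟩)
  else
    (maximalIdeal S.1.toSubring).map (algebraMap S.1.toSubring (Completion S.1))

end NuTree

end Tree

end ImplicitIdeal

namespace ImplicitIdeal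

open IsLocalRing

section Completion

variable {L : Type*} [Field L]

/-! For `l < r` the contraction property already holds for each `β` separately. An element `x` of
`Ŝ` satisfies the condition for `β` exactly when its image in some `Â`, with `A` in `𝒯(S)`, lies in
`P_β(A) Â` (`toLim_mem_limIdeal_iff`). This persists when `A` grows, and `𝒯(S')` is cofinal in
`𝒯(S)` because the tree is directed, so it may be tested over `S'` instead
(`toLim_completionMap_mem_limIdeal_iff`). Injectivity of `Ŝ → Ŝ'` plays no role. For `l = r` both
ideals are the maximal ideals of the completions, and locality of `S → S'` suffices
(`comap_completionMap_map_maximalIdeal`). -/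

theorem evalₐ_completionMap {S S' : LocalSubring L} (h : S ≤ S') (n : ℕ) (x : Completion S) :
    AdicCompletion.evalₐ (maximalIdeal S'.toSubring) n (completionMap h x) =
      completionMapAux h n x :=
  AdicCompletion.evalₐ_liftRingHom _ _ _ n x

theorem completionMapAux_apply {S S' : LocalSubring L} (h : S ≤ S') (n : ℕ) (x : Completion S) :
    completionMapAux h n x = Ideal.quotientMap (maximalIdeal S'.toSubring ^ n) (incl h)
      (maximalIdeal_pow_le_comap h n) (AdicCompletion.evalₐ (maximalIdeal S.toSubring) n x) :=
  rfl

theorem completionMap_algebraMap {S S' : LocalSubring L} (h : S ≤ S') (x : S.toSubring) :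
    completionMap h (algebraMap S.toSubring (Completion S) x) =
      algebraMap S'.toSubring (Completion S') (incl h x) := by
  refine AdicCompletion.ext_evalₐ fun n ↦ ?_
  rw [evalₐ_completionMap, completionMapAux_apply, AlgHom.commutes, AlgHom.commutes]
  exact Ideal.quotientMap_mk

theorem completionMap_refl {S : LocalSubring L} (h : S ≤ S) (x : Completion S) :
    completionMap h x = x := by
  refine AdicCompletion.ext_evalₐ fun n ↦ ?_
  rw [evalₐ_completionMap, completionMapAux_apply]
  -- Elements of a completion are determined by their residues modulo powers of the maximal ideal;
  -- on a representative the induced map is the inclusion.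
  obtain ⟨y, hy⟩ := Ideal.Quotient.mk_surjective
    (AdicCompletion.evalₐ (maximalIdeal S.toSubring) n x)
  rw [← hy, Ideal.quotientMap_mk]
  rfl

theorem completionMap_completionMap {S S' S'' : LocalSubring L} (h : S ≤ S') (h' : S' ≤ S'')
    (x : Completion S) :
    completionMap h' (completionMap h x) = completionMap (h.trans h') x := by
  refine AdicCompletion.ext_evalₐ fun n ↦ ?_
  rw [evalₐ_completionMap, evalₐ_completionMap, completionMapAux_apply, completionMapAux_apply,
    evalₐ_completionMap, completionMapAux_apply]
  obtain ⟨y, hy⟩ := Ideal.Quotient.mk_surjective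
    (AdicCompletion.evalₐ (maximalIdeal S.toSubring) n x)
  rw [← hy, Ideal.quotientMap_mk, Ideal.quotientMap_mk, Ideal.quotientMap_mk]
  rfl

/-- The maximal ideal of the completion of a noetherian local ring contracts, under the
completion of a local inclusion, to the maximal ideal. -/
theorem comap_completionMap_map_maximalIdeal {S S' : LocalSubring L} (h : S ≤ S')
    [IsNoetherianRing S.toSubring] [IsNoetherianRing S'.toSubring] :
    ((maximalIdeal S'.toSubring).map (algebraMap S'.toSubring (Completion S'))).comap
        (completionMap h) =
      (maximalIdeal S.toSubring).map (algebraMap S.toSubring (Completion S)) := by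
  have hS : ((maximalIdeal S.toSubring).map
      (algebraMap S.toSubring (Completion S))).IsMaximal := by
    rw [← AdicCompletion.maximalIdeal_eq_map]
    infer_instance
  have hS' : ((maximalIdeal S'.toSubring).map
      (algebraMap S'.toSubring (Completion S'))).IsMaximal := by
    rw [← AdicCompletion.maximalIdeal_eq_map]
    infer_instance
  -- The contraction is proper, so by maximality it is enough that it contains `m Ŝ`, which can be
  -- checked on `m`.
  refine (hS.eq_of_le (Ideal.comap_ne_top _ hS'.ne_top) ?_).symm
  rw [Ideal.map_le_iff_le_comap]
  intro x hx
  rw [Ideal.mem_comap, Ideal.mem_comap, completionMap_algebraMap]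
  refine Ideal.mem_map_of_mem _ ?_
  have : maximalIdeal S.toSubring ≤ (maximalIdeal S'.toSubring).comap (incl h) :=
    ((local_hom_TFAE (incl h)).out 0 3).mp h.2
  exact this hx

end Completion

namespace NuTree

variable {L : Type*} [Field L]
variable {Γ : Type*} [AddCommGroup Γ] [LinearOrder Γ] [IsOrderedAddMonoid Γ]
variable {ν : AddValuation L (WithTop Γ)} {R : LocalSubring L} (T : NuTree ν R)

instance (S : T.carrier) : Nonempty (T.Over S) := ⟨⟨S, le_rfl⟩⟩

theorem exists_ge_ge (A B : T.carrier) : ∃ C : T.carrier, A ≤ C ∧ B ≤ C := by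
  obtain ⟨C, hC, hAC, hBC⟩ := T.directed A.1 A.2 B.1 B.2
  exact ⟨⟨C, hC⟩, hAC, hBC⟩

instance (S : T.carrier) : IsDirectedOrder (T.Over S) where
  directed A B := by
    obtain ⟨C, hAC, hBC⟩ := T.exists_ge_ge A.1 B.1
    exact ⟨⟨C, A.2.trans hAC⟩, hAC, hBC⟩

instance (S : T.carrier) : DirectedSystem (fun S' : T.Over S ↦ Completion S'.1.1)
    (fun _ _ h ↦ completionMap h) where
  map_self _ x := completionMap_refl _ x
  map_map _ _ _ h h' x := completionMap_completionMap h h' x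

theorem toLim_completionMap {S : T.carrier} {A B : T.Over S} (h : A ≤ B) (x : Completion A.1.1) :
    T.toLim S B (completionMap h x) = T.toLim S A x :=
  Ring.DirectLimit.of_f (G := fun S' : T.Over S ↦ Completion S'.1.1)
    (f := fun _ _ h ↦ completionMap h) h x

theorem exists_toLim_eq {S : T.carrier} (z : T.LimCompletion S) :
    ∃ (A : T.Over S) (x : Completion A.1.1), T.toLim S A x = z :=
  Ring.DirectLimit.exists_of z

theorem completionMap_mem_completedIdeal {A B : T.carrier} (h : A.1 ≤ B.1) (β : Γ)
    {x : Completion A.1} (hx : x ∈ T.completedIdeal A β) :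
    completionMap h x ∈ T.completedIdeal B β := by
  suffices T.completedIdeal A β ≤ (T.completedIdeal B β).comap (completionMap h) from this hx
  refine Ideal.map_le_iff_le_comap.mpr fun y hy ↦ ?_
  rw [Ideal.mem_comap, Ideal.mem_comap, completionMap_algebraMap]
  exact Ideal.mem_map_of_mem _ hy

/-- Since the tree is directed, `lim P_β(S') Ŝ'` is the union of the images of the `P_β(S') Ŝ'`. -/
theorem mem_limIdeal_iff {S : T.carrier} {β : Γ} {z : T.LimCompletion S} :
    z ∈ T.limIdeal S β ↔
      ∃ S' : T.Over S, ∃ y ∈ T.completedIdeal S'.1 β, T.toLim S S' y = z := by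
  refine ⟨fun hz ↦ ?_, ?_⟩
  -- The union of the images is itself an ideal: two elements, or a scalar and an element, can be
  -- moved to a common stage `C`. Hence it contains the supremum defining `limIdeal`.
  · let J : Ideal (T.LimCompletion S) :=
      { carrier := {z | ∃ S' : T.Over S, ∃ y ∈ T.completedIdeal S'.1 β, T.toLim S S' y = z}
        zero_mem' := ⟨⟨S, le_rfl⟩, 0, Ideal.zero_mem _, map_zero _⟩
        add_mem' := by
          rintro _ _ ⟨A, x, hx, rfl⟩ ⟨B, y, hy, rfl⟩
          obtain ⟨C, hAC, hBC⟩ := _root_.exists_ge_ge A B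
          exact ⟨C, completionMap hAC x + completionMap hBC y,
            Ideal.add_mem _ (T.completionMap_mem_completedIdeal hAC β hx)
              (T.completionMap_mem_completedIdeal hBC β hy), by
            rw [map_add, toLim_completionMap, toLim_completionMap]⟩
        smul_mem' := by
          rintro c _ ⟨B, y, hy, rfl⟩
          obtain ⟨A, x, rfl⟩ := T.exists_toLim_eq c
          obtain ⟨C, hAC, hBC⟩ := _root_.exists_ge_ge A B
          exact ⟨C, completionMap hAC x * completionMap hBC y,
            Ideal.mul_mem_left _ _ (T.completionMap_mem_completedIdeal hBC β hy), by
            rw [map_mul, toLim_completionMap, toLim_completionMap, smul_eq_mul]⟩ }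
    have hJ : T.limIdeal S β ≤ J :=
      iSup_le fun S' ↦ Ideal.map_le_iff_le_comap.mpr fun y hy ↦ ⟨S', y, hy, rfl⟩
    exact hJ hz
  · rintro ⟨S', y, hy, rfl⟩
    exact Ideal.mem_iSup_of_mem S' (Ideal.mem_map_of_mem _ hy)

/-- An element of `Ŝ` lies in the contraction of `lim P_β(S') Ŝ'` if and only if its image in
some `Ŝ'` lies in `P_β(S') Ŝ'`. -/
theorem toLim_mem_limIdeal_iff {S : T.carrier} {β : Γ} {x : Completion S.1} :
    T.toLim S ⟨S, le_rfl⟩ x ∈ T.limIdeal S β ↔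
      ∃ S' : T.carrier, ∃ h : S.1 ≤ S'.1, completionMap h x ∈ T.completedIdeal S' β := by
  rw [mem_limIdeal_iff]
  constructor
  · rintro ⟨A, y, hy, hyx⟩
    let f (A B : T.Over S) (h : A ≤ B) : Completion A.1.1 →+* Completion B.1.1 := completionMap h
    have h0 : T.toLim S A (y - completionMap A.2 x) = 0 := by
      rw [map_sub, hyx, sub_eq_zero]
      exact (T.toLim_completionMap (show (⟨S, le_rfl⟩ : T.Over S) ≤ A from A.2) x).symm
    -- The maps to the limit need not be injective, but a difference that vanishes in the limit
    -- already vanishes at some stage `B`; there the image of `x` equals that of `y`.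
    obtain ⟨B, hAB, hB⟩ := Ring.DirectLimit.of.zero_exact (f' := f) h0
    refine ⟨B.1, B.2, ?_⟩
    have hB' : completionMap hAB (y - completionMap A.2 x) = 0 := hB
    rw [map_sub, completionMap_completionMap, sub_eq_zero] at hB'
    rw [← hB']
    exact T.completionMap_mem_completedIdeal hAB β hy
  · rintro ⟨A, h, hx⟩
    exact ⟨⟨A, h⟩, _, hx, T.toLim_completionMap
      (show (⟨S, le_rfl⟩ : T.Over S) ≤ ⟨A, h⟩ from h) x⟩

/-- A stage over `S'` is also a stage over `S`. Conversely, a stage `A` over `S` may be replaced by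
a common upper bound of `A` and `S'`. -/
theorem toLim_completionMap_mem_limIdeal_iff {S S' : T.carrier} (h : S.1 ≤ S'.1) {β : Γ}
    {x : Completion S.1} :
    T.toLim S' ⟨S', le_rfl⟩ (completionMap h x) ∈ T.limIdeal S' β ↔
      T.toLim S ⟨S, le_rfl⟩ x ∈ T.limIdeal S β := by
  rw [toLim_mem_limIdeal_iff, toLim_mem_limIdeal_iff]
  constructor
  · rintro ⟨A, hA, hx⟩
    rw [completionMap_completionMap] at hx
    exact ⟨A, _, hx⟩
  · rintro ⟨A, hA, hx⟩
    obtain ⟨B, hAB, hB⟩ := T.exists_ge_ge A S'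
    refine ⟨B, hB, ?_⟩
    have := T.completionMap_mem_completedIdeal hAB β hx
    rwa [completionMap_completionMap] at this ⊢

end NuTree

end ImplicitIdeal

theorem mainTheorem5 {L : Type*} [Field L]
    {Γ : Type*} [AddCommGroup Γ] [LinearOrder Γ] [IsOrderedAddMonoid Γ]
    (ν : AddValuation L (WithTop Γ)) (hν : Function.Surjective ν)
    {r : ℕ} (Δ : Fin (r + 1) → AddSubgroup Γ) (hΔ : ImplicitIdeal.IsIsolatedChain Δ)
    (R : LocalSubring L) (T : ImplicitIdeal.NuTree ν R)
    (S S' : T.carrier) (h : S.1 ≤ S'.1) (l : Fin (r + 1)) :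
    (T.oddImplicitIdeal Δ S' l).comap (ImplicitIdeal.completionMap h) =
      T.oddImplicitIdeal Δ S l := by
  have := T.isNoetherianRing S.1 S.2
  have := T.isNoetherianRing S'.1 S'.2
  unfold ImplicitIdeal.NuTree.oddImplicitIdeal
  split_ifs
  · ext x
    simp only [Ideal.mem_comap, Submodule.mem_iInf]
    -- Contraction commutes with intersections, so each `β` is treated alone; no property of `Δ l`
    -- enters.
    exact forall₂_congr fun β _ ↦ T.toLim_completionMap_mem_limIdeal_iff h
  · exact ImplicitIdeal.comap_completionMap_map_maximalIdeal h
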